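/- **Setting.** A *history* consists of a set $\mathrm{Ev}$ of events, each of which is either $push(v)$ with input $v$ in a set $\mathrm{Val}$ of values or $pop()$; a set of rep events with a strict total order $<$; and the following data. Each event $e$ has a start time $\mathrm{st}(e)\in\mathbb N$ and, if it has terminated, an end time $\mathrm{et}(e)\in\mathbb N$ with $\mathrm{st}(e)\le\mathrm{et}(e)$ and an output $\mathrm{out}(e)$ (both are undefined for unterminated events). Outputs lie in the disjoint union $\{tt\}\sqcup\{\mathrm{EMPTY}\}\sqcup\mathrm{Val}$. Each rep event $r$ has a time $\mathrm{time}(r)\in\mathbb N$, with $\mathrm{time}(r)<\mathrm{time}(r')\Rightarrow r<r'$. There are partial functions on events: the span $\mathcal S(e)=(\mathcal S(e)_1,\mathcal S(e)_2)$, a pair of rep events; the node id $id(e)\in\mathbb N$; the timestamp $t_s(e)$ in a set of timestamps; and the associated output $\mathrm O(e)$. Let $at_s(e)=(id(e),t_s(e))$ be the abstract timestamp, defined when both components are. An atomic formula is true only if all terms in it are defined. Variables $u$ range over pushes, $o$ over pops, $x,y,z$ over all events. Write $x\sqsubset y$ for $\mathrm{et}(x)<\mathrm{st}(y)$, $\mathcal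 S(x)\sqsubset^S\mathcal S(y)$ for $\mathcal S(x)_2<\mathcal S(y)_1$, and $T$ for the set of terminated events. A push $u$ and a pop $o$ form an *elimination pair*, $\mathrm{Elim}(u,o)$, if $id(u)=id(o)$ and $u\not\sqsubset o$; $E$ is the set of events occurring in elimination pairs, and $\hat y$ denotes the event coupled with $y\in E$. Assume that there are finitely many elimination pairs, and let $p_0,\dots,p_{n-1}$ be any enumeration of them without repetition. Let $\ll$ be a strict partial order on abstract timestamps (with reflexive closure $\underline\ll$) that is *pop-total*: for all $u_1,u_2,o\notin E$ such that $at_s(u_1)$, $at_s(u_2)$ are defined, if $at_s(u_1)=at_s(o)$ or $at_s(u_2)=at_s(o)$, then $at_s(u_1)\ll at_s(u_2)$ or $at_s(u_2)\ll at_s(u_1)$ or $at_s(u_1)=at_s(u_2)$. **Relations.** $\mathrm{Miss}(o,u)$ means: $o,u\notin E$, $at_s(o)\ll at_s(u)$, and $\mathcal S(o)_2<\mathcal S(o')_2$ for every pop $o'\notin E$ with $at_s(u)=at_s(o')$. Put $M(o,x)\Leftrightarrow\exists u'\notin E.\ \mathrm{Miss}(o,u')\wedge at_s(u')\mathrel{\underline\ll}at_s(x)$.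 The relations at level $0$, restricted to events outside $E$, are: $u\lessdot_0 o\Leftrightarrow at_s(u)=at_s(o)$; $u_1\ltimes_0u_2\Leftrightarrow at_s(u_1)\ll at_s(u_2)$; $o\ltimes_0u\Leftrightarrow M(o,u)$; $o_2\ltimes_0o_1\Leftrightarrow at_s(o_1)\ll at_s(o_2)\wedge\neg M(o_1,o_2)$ (and no other pairs are related). Let $P_i$ be the set of the two events of $p_i$, $E_0=E$, $E_{i+1}=E_i\setminus P_i$, ${\prec_i}={\lessdot_i}\cup{\ltimes_i}$, and $\mathrm{BE}_i(x,y)\Leftrightarrow y\in E\wedge\exists z.\ x\prec_i^*z\wedge(z\sqsubset\hat y\vee z\sqsubset y)$. For $i<n$, $u\lessdot_{i+1}o$ iff $u\lessdot_io$ or $p_i=(u,o)$; and $x\ltimes_{i+1}y$ iff $(x\notin E_i\wedge y\in P_i\wedge\mathrm{BE}_i(x,y))$ or $(x\in P_i\wedge y\notin E_i\wedge\neg\mathrm{BE}_i(y,x))$ or $x\ltimes_iy$. The final relations are ${\lessdot}={\lessdot_n}$ and ${\ltimes}={\ltimes_n}$; put ${\prec}={\lessdot}\cup{\ltimes}$,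 and let $\overline T=\{e\mid\exists t\in T.\ e\prec^*t\}$ be the closure of the terminated events. **Hypotheses.** Assume the key invariants - $\mathcal S(u_1)\sqsubset^S\mathcal S(u_2)\Rightarrow at_s(u_1)\ll at_s(u_2)$ (disjoint push timestamp generation); - $\mathrm{Miss}(o,u)\Rightarrow\mathcal S(o)_1<\mathcal S(u)_1$ (misses start late); and the structural invariants - $id(u)=id(o)\Rightarrow\neg(\mathrm{time}(\mathcal S(o)_2)<\mathrm{st}(u))$; - $\mathcal S(x)$ defined $\Rightarrow\mathcal S(x)_1\le\mathcal S(x)_2$; - $id(u)=id(o)\wedge\mathcal S(u)\sqsubset^S\mathcal S(o)\Rightarrow t_s(u)=t_s(o)$; - $id(o)$ defined $\Rightarrow\mathcal S(o)$ defined; - $t_s(x)$ defined $\Rightarrow\mathcal S(x)$ defined; - $x\in T\Rightarrow\mathcal S(x)$ defined and $\mathrm{out}(x)=\mathrm O(x)$; - $\mathcal S(x)$ defined $\Rightarrow t_s(x)$, $id(x)$, $\mathrm O(x)$ defined; - $\mathcal S(x)=\mathcal S(y)\Rightarrow x=y$; - $\mathcal S(x)_2=\mathcal S(y)_2\Rightarrow\mathcal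 S(x)=\mathcal S(y)$; - $id(u_1)=id(u_2)\Rightarrow u_1=u_2$, and $id(o_1)=id(o_2)\Rightarrow o_1=o_2$; - $\mathcal S(x)$ defined $\Rightarrow\mathrm{st}(x)\le\mathrm{time}(\mathcal S(x)_1)$, and $\mathrm{et}(x)$ defined $\Rightarrow\mathrm{time}(\mathcal S(x)_2)\le\mathrm{et}(x)$; - $id(o)$ defined $\Rightarrow\exists u.\ id(u)=id(o)$ and $\mathrm O(o)$ is the input of $u$; and $id(u)$ defined $\Rightarrow\mathrm O(u)=tt$. **Conclusion.** The visibility-style axioms hold, with all event variables (including the existentially quantified ones) ranging over $\overline T$, and with $\underline\ltimes$ and $\sqsubseteq$ the reflexive closures of $\ltimes$ and $\sqsubset$: 1. (Concurrent LIFO) if $u_1\lessdot o_1$, $\neg(o_1\mathrel{\underline\ltimes}u_2)$ and $\neg(u_2\mathrel{\underline\ltimes}u_1)$, then there is $o_2$ with $u_2\lessdot o_2$ and $o_2\ltimes o_1$; 2. (Pop uniqueness) if $u\lessdot o_1$ and $u\lessdot o_2$, then $o_1=o_2$; 3. (No future dependences) if $x\prec^+y$, then $y\not\sqsubseteq x$;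 4. (Return value completion) for every $x$ there is an output $v$ with $\mathrm{Post}(x,v)$, and $v=\mathrm{out}(x)$ if $x\in T$. Here $\mathrm{Post}(u,v)$ means $v=tt$; for $v\ne\mathrm{EMPTY}$, $\mathrm{Post}(o,v)$ means that there is $u\lessdot o$ with input $v$; and $\mathrm{Post}(o,\mathrm{EMPTY})$ means that for every $u$ with $\neg(o\mathrel{\underline\ltimes}u)$ there is $o_2$ with $u\lessdot o_2$ and $o_2\ltimes o$. -/

import Mathlib

namespace TSStack

universe u

/-- Stack operations: `push v` carries its input value; `pop` has no input. -/
inductive Op (Val : Type u) where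
  | push (v : Val)
  | pop

/-- Outputs of stack operations: the trivial value `tt` (of pushes), the answer `EMPTY`
(which is not a value), or a value. -/
inductive Out (Val : Type u) where
  | tt
  | empty
  | val (v : Val)

/-- An execution history of a timestamped stack: events `Ev`, rep events `Rep` with their strict
total real-time order, timestamps `TS` and stack values `Val`. Partial functions are
`Option`-valued, with `none` for "undefined". -/
structure History (Ev Rep TS Val : Type*) [LinearOrder Rep] where
  /-- The operation invoked by an event, together with its input. -/
  op : Ev → Op Val
  startTime : Ev → ℕ
  /-- Defined exactly for the terminated events. -/
  endTime : Ev → Option ℕ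
  /-- The actual output of a terminated event. -/
  output : Ev → Option (Out Val)
  repTime : Rep → ℕ
  /-- The span executed by an event: its initial and its final rep event. -/
  span : Ev → Option (Rep × Rep)
  /-- The id of the node pushed (by a push) or taken (by a pop). -/
  nodeId : Ev → Option ℕ
  /-- The timestamp generated (by a push) or that of the taken node (for a pop). -/
  stamp : Ev → Option TS
  /-- The output associated with a possibly unterminated event. -/
  effOut : Ev → Option (Out Val)
  start_le_end : ∀ e t, endTime e = some t → startTime e ≤ t
  output_undef : ∀ e, endTime e = none → output e = none
  repTime_mono : Monotone repTime

namespace History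

variable {Ev Rep TS Val : Type*} [LinearOrder Rep] (H : History Ev Rep TS Val)

def IsPush (x : Ev) : Prop := ∃ v, H.op x = Op.push v

def IsPop (x : Ev) : Prop := H.op x = Op.pop

/-- The set `T` of terminated events. -/
def Terminated (x : Ev) : Prop := ∃ t, H.endTime x = some t

/-- The returns-before relation `x ⊏ y`. -/
def ReturnsBefore (x y : Ev) : Prop := ∃ t, H.endTime x = some t ∧ t < H.startTime y

/-- The abstract timestamp: node id together with timestamp. -/
def aStamp (x : Ev) : Option (ℕ × TS) := Option.map₂ Prod.mk (H.nodeId x) (H.stamp x)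

/-! An atomic formula holds only if all the partial functions in it are defined. -/

/-- `id x = id y`. -/
def SameId (x y : Ev) : Prop := ∃ i, H.nodeId x = some i ∧ H.nodeId y = some i

/-- Equality of the abstract timestamps of `x` and `y`. -/
def SameAStamp (x y : Ev) : Prop := ∃ s, H.aStamp x = some s ∧ H.aStamp y = some s

/-- The abstract timestamps of `x` and `y` are related by `ll`. -/
def AStampLT (ll : ℕ × TS → ℕ × TS → Prop) (x y : Ev) : Prop :=
  ∃ s t, H.aStamp x = some s ∧ H.aStamp y = some t ∧ ll s t

/-- The abstract timestamps of `x` and `y` are related by the reflexive closure of `ll`. -/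
def AStampLE (ll : ℕ × TS → ℕ × TS → Prop) (x y : Ev) : Prop :=
  ∃ s t, H.aStamp x = some s ∧ H.aStamp y = some t ∧ (ll s t ∨ s = t)

/-- The span of `x` ends before the span of `y` starts. -/
def SpanPrecedes (x y : Ev) : Prop :=
  ∃ a b, H.span x = some a ∧ H.span y = some b ∧ a.2 < b.1

/-- The span of `x` starts before the span of `y` starts. -/
def SpanStartLT (x y : Ev) : Prop :=
  ∃ a b, H.span x = some a ∧ H.span y = some b ∧ a.1 < b.1

/-- The span of `x` ends before the span of `y` ends. -/
def SpanEndLT (x y : Ev) : Prop :=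
  ∃ a b, H.span x = some a ∧ H.span y = some b ∧ a.2 < b.2

/-- Push `x` and pop `y` form an elimination pair. -/
def Elim (x y : Ev) : Prop :=
  H.IsPush x ∧ H.IsPop y ∧ H.SameId x y ∧ ¬ H.ReturnsBefore x y

/-- The set `E` of events that occur in elimination pairs. -/
def elimSet : Set Ev := {x | ∃ y, H.Elim x y ∨ H.Elim y x}

/-- Pop-totality of an order on abstract timestamps: the abstract timestamps of two pushes are
comparable as soon as one of the pushes is taken by a pop (elimination pairs being excluded). -/
def PopTotal (ll : ℕ × TS → ℕ × TS → Prop) : Prop :=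
  ∀ u₁ u₂ o, H.IsPush u₁ → H.IsPush u₂ → H.IsPop o →
    u₁ ∉ H.elimSet → u₂ ∉ H.elimSet → o ∉ H.elimSet →
    ∀ s₁ s₂, H.aStamp u₁ = some s₁ → H.aStamp u₂ = some s₂ →
      (H.SameAStamp u₁ o ∨ H.SameAStamp u₂ o) → ll s₁ s₂ ∨ ll s₂ s₁ ∨ s₁ = s₂

/-- Pop `o` misses push `u`. -/
def Miss (ll : ℕ × TS → ℕ × TS → Prop) (o u : Ev) : Prop :=
  H.IsPop o ∧ H.IsPush u ∧ o ∉ H.elimSet ∧ u ∉ H.elimSet ∧ H.AStampLT ll o u ∧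
    ∀ o', H.IsPop o' → o' ∉ H.elimSet → H.SameAStamp u o' → H.SpanEndLT o o'

/-- Pop `o` misses some push whose abstract timestamp is at most that of `x`. -/
def MissUpTo (ll : ℕ × TS → ℕ × TS → Prop) (o x : Ev) : Prop :=
  ∃ u', u' ∉ H.elimSet ∧ H.Miss ll o u' ∧ H.AStampLE ll u' x

/-- The base visibility relation (between pushes and pops). -/
def BaseVis (u o : Ev) : Prop :=
  H.IsPush u ∧ H.IsPop o ∧ u ∉ H.elimSet ∧ o ∉ H.elimSet ∧ H.SameAStamp u o

/-- The base separability relation: its three cases relate pushes to pushes, pops to pushes and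
pops to pops. -/
def BaseSep (ll : ℕ × TS → ℕ × TS → Prop) (x y : Ev) : Prop :=
  x ∉ H.elimSet ∧ y ∉ H.elimSet ∧
    ((H.IsPush x ∧ H.IsPush y ∧ H.AStampLT ll x y) ∨
     (H.IsPop x ∧ H.IsPush y ∧ H.MissUpTo ll x y) ∨
     (H.IsPop x ∧ H.IsPop y ∧ H.AStampLT ll y x ∧ ¬ H.MissUpTo ll y x))

/-- `enum` lists the elimination pairs without repetition; in particular `n` is their number. -/
def IsElimEnum {n : ℕ} (enum : Fin n → Ev × Ev) : Prop :=
  Function.Injective enum ∧ ∀ u o, (∃ i, enum i = (u, o)) ↔ H.Elim u o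

/-- The events in the `i`-th elimination pair. -/
def pairSet {n : ℕ} (enum : Fin n → Ev × Ev) (i : ℕ) : Set Ev :=
  {x | ∃ h : i < n, x = (enum ⟨i, h⟩).1 ∨ x = (enum ⟨i, h⟩).2}

/-- The events in all the elimination pairs but the first `i`. -/
def elimSetFrom {n : ℕ} (enum : Fin n → Ev × Ev) : ℕ → Set Ev
  | 0 => H.elimSet
  | i + 1 => elimSetFrom enum i \ pairSet enum i

/-- `x` should be ordered before the elimination pair event `y`, given the constraint
relation `prec`; the event `c` is the one coupled with `y`. -/
def BE (prec : Ev → Ev → Prop) (x y : Ev) : Prop :=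
  y ∈ H.elimSet ∧ ∃ z, Relation.ReflTransGen prec x z ∧
    ((∃ c, (H.Elim y c ∨ H.Elim c y) ∧ H.ReturnsBefore z c) ∨ H.ReturnsBefore z y)

/-- The visibility relation when the first `i` elimination pairs have been included. -/
def visAt {n : ℕ} (enum : Fin n → Ev × Ev) : ℕ → Ev → Ev → Prop
  | 0 => H.BaseVis
  | i + 1 => fun u o => visAt enum i u o ∨ ∃ h : i < n, enum ⟨i, h⟩ = (u, o)

/-- The separability relation when the first `i` elimination pairs have been included. -/
def sepAt (ll : ℕ × TS → ℕ × TS → Prop) {n : ℕ} (enum : Fin n → Ev × Ev) :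
    ℕ → Ev → Ev → Prop
  | 0 => H.BaseSep ll
  | i + 1 => fun x y =>
      (x ∉ H.elimSetFrom enum i ∧ y ∈ pairSet enum i ∧
        H.BE (fun a b => H.visAt enum i a b ∨ sepAt ll enum i a b) x y) ∨
      (x ∈ pairSet enum i ∧ y ∉ H.elimSetFrom enum i ∧
        ¬ H.BE (fun a b => H.visAt enum i a b ∨ sepAt ll enum i a b) y x) ∨
      sepAt ll enum i x y

/-- The final visibility relation. -/
def vis {n : ℕ} (enum : Fin n → Ev × Ev) : Ev → Ev → Prop := H.visAt enum n

/-- The final separability relation. -/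
def sep (ll : ℕ × TS → ℕ × TS → Prop) {n : ℕ} (enum : Fin n → Ev × Ev) : Ev → Ev → Prop :=
  H.sepAt ll enum n

/-- The key invariants. -/
structure KeyInvariants (ll : ℕ × TS → ℕ × TS → Prop) : Prop where
  disjoint_push : ∀ u₁ u₂, H.IsPush u₁ → H.IsPush u₂ →
    H.SpanPrecedes u₁ u₂ → H.AStampLT ll u₁ u₂
  misses_start_late : ∀ o u, H.Miss ll o u → H.SpanStartLT o u

/-- The structural invariants. -/
structure StructuralInvariants : Prop where
  pop_not_before_push : ∀ u o, H.IsPush u → H.IsPop o → H.SameId u o →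
    ¬ ∃ a, H.span o = some a ∧ H.repTime a.2 < H.startTime u
  span_start_le_end : ∀ x a, H.span x = some a → a.1 ≤ a.2
  stamps_equal : ∀ u o, H.IsPush u → H.IsPop o → H.SameId u o → H.SpanPrecedes u o →
    ∃ t, H.stamp u = some t ∧ H.stamp o = some t
  pop_id_span : ∀ o, H.IsPop o → (∃ i, H.nodeId o = some i) → ∃ a, H.span o = some a
  stamp_span : ∀ x, (∃ t, H.stamp x = some t) → ∃ a, H.span x = some a
  terminated_span : ∀ x, H.Terminated x →
    (∃ a, H.span x = some a) ∧ ∃ v, H.output x = some v ∧ H.effOut x = some v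
  span_all : ∀ x, (∃ a, H.span x = some a) →
    (∃ t, H.stamp x = some t) ∧ (∃ i, H.nodeId x = some i) ∧ ∃ v, H.effOut x = some v
  span_inj : ∀ x y a, H.span x = some a → H.span y = some a → x = y
  span_end_inj : ∀ x y a b, H.span x = some a → H.span y = some b → a.2 = b.2 → a = b
  push_id_inj : ∀ u₁ u₂, H.IsPush u₁ → H.IsPush u₂ → H.SameId u₁ u₂ → u₁ = u₂
  pop_id_inj : ∀ o₁ o₂, H.IsPop o₁ → H.IsPop o₂ → H.SameId o₁ o₂ → o₁ = o₂
  start_le_span : ∀ x a, H.span x = some a → H.startTime x ≤ H.repTime a.1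
  span_le_end : ∀ x t, H.endTime x = some t → ∃ a, H.span x = some a ∧ H.repTime a.2 ≤ t
  pops_take_pushes : ∀ o, H.IsPop o → (∃ i, H.nodeId o = some i) →
    ∃ u v, H.op u = Op.push v ∧ H.SameId u o ∧ H.effOut o = some (Out.val v)
  push_out : ∀ u, H.IsPush u → (∃ i, H.nodeId u = some i) → H.effOut u = some Out.tt

/-- The closure of the set of terminated events under the constraint relation, the union of the
relations `V` (visibility) and `S` (separability). -/
def Closed (V S : Ev → Ev → Prop) (e : Ev) : Prop :=
  ∃ t, H.Terminated t ∧ Relation.ReflTransGen (fun a b => V a b ∨ S a b) e t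

/-- The postcondition predicate: output `w` is suitable for event `x`. -/
def Post (V S : Ev → Ev → Prop) (x : Ev) (w : Out Val) : Prop :=
  (H.IsPush x → w = Out.tt) ∧
  (H.IsPop x →
    (w ≠ Out.empty → ∃ u v, H.Closed V S u ∧ H.op u = Op.push v ∧ V u x ∧ w = Out.val v) ∧
    (w = Out.empty → ∀ u, H.Closed V S u → H.IsPush u → ¬ (x = u ∨ S x u) →
      ∃ o, H.Closed V S o ∧ H.IsPop o ∧ V u o ∧ S o x))

/-- The visibility-style axioms for stacks, for a visibility relation `V` and a separability
relation `S`; all event variables range over the closure of the terminated events. -/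
structure VisibilityAxioms (V S : Ev → Ev → Prop) : Prop where
  concurrent_lifo : ∀ u₁ o₁ u₂, H.Closed V S u₁ → H.Closed V S o₁ → H.Closed V S u₂ →
    H.IsPush u₁ → H.IsPop o₁ → H.IsPush u₂ →
    V u₁ o₁ → ¬ (o₁ = u₂ ∨ S o₁ u₂) → ¬ (u₂ = u₁ ∨ S u₂ u₁) →
    ∃ o₂, H.Closed V S o₂ ∧ H.IsPop o₂ ∧ V u₂ o₂ ∧ S o₂ o₁
  pop_unique : ∀ u o₁ o₂, H.Closed V S u → H.Closed V S o₁ → H.Closed V S o₂ →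
    H.IsPush u → H.IsPop o₁ → H.IsPop o₂ → V u o₁ → V u o₂ → o₁ = o₂
  no_future : ∀ x y, H.Closed V S x → H.Closed V S y →
    Relation.TransGen (fun a b => V a b ∨ S a b) x y → ¬ (y = x ∨ H.ReturnsBefore y x)
  return_completion : ∀ x, H.Closed V S x →
    ∃ w, H.Post V S x w ∧ (H.Terminated x → H.output x = some w)

end History

end TSStack

namespace TSStack

namespace History

variable {Ev Rep TS Val : Type*} [LinearOrder Rep] {H : History Ev Rep TS Val}
  {ll : ℕ × TS → ℕ × TS → Prop}

/-! ### Events and abstract timestamps -/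

/-! A pop outside the elimination pairs carries the abstract timestamp of a push that returned
before it (`exists_push`), so pop-totality compares it with every stamped push outside the pairs
(`push_le_pop_or_lt`). At level 0, separability between pops forces the earlier one to end first,
and misses propagate backwards along it. Hence paths of the base relation stay within the few shapes
of `BaseReach`. None of these is a loop. If the target of a path returned before its source, then
either two pops would end in the wrong order, or some push would precede in time a push whose
timestamp is not larger, against `disjoint_push`; `misses_start_late` supplies the time order when a
miss is involved.

Elimination pairs are inserted one by one. The events already present split into those that reach an
event returning before a member of the pair, and the rest; the former go before both members, the
latter after. The first class is closed under predecessors, so a path through the pair only crosses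
from the first class to the second, and no future dependence arises (`noFuture_extendByPair`).

For concurrent LIFO, an event present when a pair is inserted is ordered the same way against both
of its members (`sep_pair`), which settles every case involving a pair; without pairs, pop-totality
and the definition of a miss suffice (`exists_vis_sep`). Return values follow because a push and a
pop with the same id are always related by visibility (`vis_of_sameId`). -/

theorem isPush_or_isPop (x : Ev) : H.IsPush x ∨ H.IsPop x := by
  unfold IsPush IsPop
  cases H.op x <;> simp

theorem IsPush.not_isPop {x : Ev} (hx : H.IsPush x) : ¬ H.IsPop x := by
  obtain ⟨v, hv⟩ := hx
  simp [IsPop, hv]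

theorem IsPop.ne_push {o u : Ev} (ho : H.IsPop o) (hu : H.IsPush u) : o ≠ u := by
  rintro rfl
  exact hu.not_isPop ho

theorem aStamp_eq_some {x : Ev} {s : ℕ × TS} :
    H.aStamp x = some s ↔ H.nodeId x = some s.1 ∧ H.stamp x = some s.2 := by
  obtain ⟨i, t⟩ := s
  simp [aStamp, Option.map₂_eq_some_iff]

theorem SameId.symm {x y : Ev} (h : H.SameId x y) : H.SameId y x := by
  obtain ⟨i, hx, hy⟩ := h
  exact ⟨i, hy, hx⟩

theorem SameId.trans {x y z : Ev} (hxy : H.SameId x y) (hyz : H.SameId y z) : H.SameId x z := by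
  obtain ⟨i, hx, hy⟩ := hxy
  obtain ⟨j, hy', hz⟩ := hyz
  rw [hy] at hy'
  cases hy'
  exact ⟨i, hx, hz⟩

theorem SameAStamp.symm {x y : Ev} (h : H.SameAStamp x y) : H.SameAStamp y x := by
  obtain ⟨s, hx, hy⟩ := h
  exact ⟨s, hy, hx⟩

theorem SameAStamp.sameId {x y : Ev} (h : H.SameAStamp x y) : H.SameId x y := by
  obtain ⟨s, hx, hy⟩ := h
  exact ⟨s.1, (aStamp_eq_some.1 hx).1, (aStamp_eq_some.1 hy).1⟩

theorem SameAStamp.le {x y : Ev} (h : H.SameAStamp x y) : H.AStampLE ll x y := by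
  obtain ⟨s, hx, hy⟩ := h
  exact ⟨s, s, hx, hy, Or.inr rfl⟩

theorem AStampLT.le {x y : Ev} (h : H.AStampLT ll x y) : H.AStampLE ll x y := by
  obtain ⟨s, t, hx, hy, hst⟩ := h
  exact ⟨s, t, hx, hy, Or.inl hst⟩

theorem AStampLE.lt_or_same {x y : Ev} (h : H.AStampLE ll x y) :
    H.AStampLT ll x y ∨ H.SameAStamp x y := by
  obtain ⟨s, t, hx, hy, hst | rfl⟩ := h
  · exact Or.inl ⟨s, t, hx, hy, hst⟩
  · exact Or.inr ⟨s, hx, hy⟩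

theorem AStampLT.trans_le (hll : IsStrictOrder (ℕ × TS) ll) {x y z : Ev}
    (hxy : H.AStampLT ll x y) (hyz : H.AStampLE ll y z) : H.AStampLT ll x z := by
  obtain ⟨a, b, hx, hy, hab⟩ := hxy
  obtain ⟨b', c, hy', hz, hbc⟩ := hyz
  rw [hy] at hy'
  cases hy'
  rcases hbc with hbc | rfl
  · exact ⟨a, c, hx, hz, hll.trans _ _ _ hab hbc⟩
  · exact ⟨a, b, hx, hz, hab⟩

theorem AStampLE.trans_lt (hll : IsStrictOrder (ℕ × TS) ll) {x y z : Ev}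
    (hxy : H.AStampLE ll x y) (hyz : H.AStampLT ll y z) : H.AStampLT ll x z := by
  obtain ⟨a, b, hx, hy, hab⟩ := hxy
  obtain ⟨b', c, hy', hz, hbc⟩ := hyz
  rw [hy] at hy'
  cases hy'
  rcases hab with hab | rfl
  · exact ⟨a, c, hx, hz, hll.trans _ _ _ hab hbc⟩
  · exact ⟨a, c, hx, hz, hbc⟩

theorem AStampLE.trans (hll : IsStrictOrder (ℕ × TS) ll) {x y z : Ev}
    (hxy : H.AStampLE ll x y) (hyz : H.AStampLE ll y z) : H.AStampLE ll x z := by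
  rcases hxy.lt_or_same with h | ⟨s, hx, hy⟩
  · exact (h.trans_le hll hyz).le
  · obtain ⟨b, c, hy', hz, hbc⟩ := hyz
    rw [hy] at hy'
    cases hy'
    exact ⟨s, c, hx, hz, hbc⟩

theorem AStampLT.irrefl (hll : IsStrictOrder (ℕ × TS) ll) (x : Ev) : ¬ H.AStampLT ll x x := by
  rintro ⟨a, b, ha, hb, hab⟩
  rw [ha] at hb
  cases hb
  exact hll.irrefl _ hab

theorem MissUpTo.mono (hll : IsStrictOrder (ℕ × TS) ll) {o x y : Ev}
    (h : H.MissUpTo ll o x) (hxy : H.AStampLE ll x y) : H.MissUpTo ll o y := by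
  obtain ⟨u, hu, hm, hle⟩ := h
  exact ⟨u, hu, hm, hle.trans hll hxy⟩

theorem MissUpTo.lt (hll : IsStrictOrder (ℕ × TS) ll) {o x : Ev}
    (h : H.MissUpTo ll o x) : H.AStampLT ll o x := by
  obtain ⟨u, hu, hm, hle⟩ := h
  exact hm.2.2.2.2.1.trans_le hll hle

theorem span_of_aStamp (hs : H.StructuralInvariants) {x : Ev} {s : ℕ × TS}
    (h : H.aStamp x = some s) : ∃ a, H.span x = some a :=
  hs.stamp_span x ⟨_, (aStamp_eq_some.1 h).2⟩

theorem aStamp_of_span (hs : H.StructuralInvariants) {x : Ev} (h : ∃ a, H.span x = some a) :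
    ∃ s, H.aStamp x = some s := by
  obtain ⟨⟨t, ht⟩, ⟨i, hi⟩, -⟩ := hs.span_all x h
  exact ⟨(i, t), aStamp_eq_some.2 ⟨hi, ht⟩⟩

/-! ### Spans -/

theorem ReturnsBefore.spanPrecedes (hs : H.StructuralInvariants) {x y : Ev}
    (h : H.ReturnsBefore x y) (hy : ∃ b, H.span y = some b) : H.SpanPrecedes x y := by
  obtain ⟨t, ht, hlt⟩ := h
  obtain ⟨b, hb⟩ := hy
  obtain ⟨a, ha, hat⟩ := hs.span_le_end x t ht
  refine ⟨a, b, ha, hb, ?_⟩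
  by_contra hcon
  have h₁ := H.repTime_mono (not_lt.1 hcon)
  have h₂ := hs.start_le_span y b hb
  omega

theorem SpanPrecedes.trans (hs : H.StructuralInvariants) {x y z : Ev}
    (hxy : H.SpanPrecedes x y) (hyz : H.SpanPrecedes y z) : H.SpanPrecedes x z := by
  obtain ⟨a, b, ha, hb, hab⟩ := hxy
  obtain ⟨b', c, hb', hc, hbc⟩ := hyz
  rw [hb] at hb'
  cases hb'
  exact ⟨a, c, ha, hc, hab.trans ((hs.span_start_le_end y b hb).trans_lt hbc)⟩

theorem SpanPrecedes.trans_start {x y z : Ev}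
    (hxy : H.SpanPrecedes x y) (hyz : H.SpanStartLT y z) : H.SpanPrecedes x z := by
  obtain ⟨a, b, ha, hb, hab⟩ := hxy
  obtain ⟨b', c, hb', hc, hbc⟩ := hyz
  rw [hb] at hb'
  cases hb'
  exact ⟨a, c, ha, hc, hab.trans hbc⟩

theorem SpanEndLT.trans_precedes {x y z : Ev}
    (hxy : H.SpanEndLT x y) (hyz : H.SpanPrecedes y z) : H.SpanPrecedes x z := by
  obtain ⟨a, b, ha, hb, hab⟩ := hxy
  obtain ⟨b', c, hb', hc, hbc⟩ := hyz
  rw [hb] at hb'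
  cases hb'
  exact ⟨a, c, ha, hc, hab.trans hbc⟩

theorem SpanEndLT.trans {x y z : Ev}
    (hxy : H.SpanEndLT x y) (hyz : H.SpanEndLT y z) : H.SpanEndLT x z := by
  obtain ⟨a, b, ha, hb, hab⟩ := hxy
  obtain ⟨b', c, hb', hc, hbc⟩ := hyz
  rw [hb] at hb'
  cases hb'
  exact ⟨a, c, ha, hc, hab.trans hbc⟩

theorem SpanEndLT.irrefl (x : Ev) : ¬ H.SpanEndLT x x := by
  rintro ⟨a, b, ha, hb, hab⟩
  rw [ha] at hb
  cases hb
  exact lt_irrefl _ hab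

theorem SpanPrecedes.irrefl (hs : H.StructuralInvariants) (x : Ev) : ¬ H.SpanPrecedes x x := by
  rintro ⟨a, b, ha, hb, hab⟩
  rw [ha] at hb
  cases hb
  exact absurd (hs.span_start_le_end x a ha) (not_le.2 hab)

/-! ### Elimination pairs -/

theorem Elim.eq_of_push (hs : H.StructuralInvariants) {u o o' : Ev}
    (h : H.Elim u o) (h' : H.Elim u o') : o = o' :=
  hs.pop_id_inj _ _ h.2.1 h'.2.1 (h.2.2.1.symm.trans h'.2.2.1)

theorem Elim.eq_of_pop (hs : H.StructuralInvariants) {u u' o : Ev}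
    (h : H.Elim u o) (h' : H.Elim u' o) : u = u' :=
  hs.push_id_inj _ _ h.1 h'.1 (h.2.2.1.trans h'.2.2.1.symm)

theorem Elim.not_returnsBefore_swap (hs : H.StructuralInvariants) {u o : Ev}
    (h : H.Elim u o) : ¬ H.ReturnsBefore o u := by
  rintro ⟨t, ht, hlt⟩
  obtain ⟨a, ha, hat⟩ := hs.span_le_end o t ht
  exact hs.pop_not_before_push u o h.1 h.2.1 h.2.2.1 ⟨a, ha, by omega⟩

/-- A pop outside the elimination pairs takes a push that returned before it. -/
theorem exists_push (hs : H.StructuralInvariants) {o : Ev} (ho : H.IsPop o)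
    (hoE : o ∉ H.elimSet) (hst : ∃ a, H.span o = some a) :
    ∃ u, H.IsPush u ∧ u ∉ H.elimSet ∧ H.SameAStamp u o ∧ H.SpanPrecedes u o := by
  obtain ⟨-, hid, -⟩ := hs.span_all o hst
  obtain ⟨u, v, huv, hsame, -⟩ := hs.pops_take_pushes o ho hid
  have hu : H.IsPush u := ⟨v, huv⟩
  have hrb : H.ReturnsBefore u o := by
    by_contra hcon
    exact hoE ⟨u, Or.inr ⟨hu, ho, hsame, hcon⟩⟩
  have hpre := hrb.spanPrecedes hs hst
  obtain ⟨t, htu, hto⟩ := hs.stamps_equal u o hu ho hsame hpre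
  obtain ⟨i, hiu, hio⟩ := id hsame
  refine ⟨u, hu, ?_, ⟨(i, t), aStamp_eq_some.2 ⟨hiu, htu⟩, aStamp_eq_some.2 ⟨hio, hto⟩⟩, hpre⟩
  -- By uniqueness of ids, the only pop that `u` could be eliminated with is `o`, which lies outside
  -- the pairs.
  rintro ⟨y, hy | hy⟩
  · have : o = y := hs.pop_id_inj _ _ ho hy.2.1 (hsame.symm.trans hy.2.2.1)
    subst this
    exact hoE ⟨u, Or.inr hy⟩
  · exact hu.not_isPop hy.2.1

/-! ### The base relations -/

/-- Pop-totality speaks of two pushes only; it is applied to `u` and the push taken by `o`, whose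
abstract timestamp is that of `o`. -/
theorem push_le_pop_or_lt (hs : H.StructuralInvariants) (hpop : H.PopTotal ll) {u o : Ev}
    (hu : H.IsPush u) (huE : u ∉ H.elimSet) (hust : ∃ s, H.aStamp u = some s)
    (ho : H.IsPop o) (hoE : o ∉ H.elimSet) (host : ∃ s, H.aStamp o = some s) :
    H.AStampLE ll u o ∨ H.AStampLT ll o u := by
  obtain ⟨s, hs₁⟩ := hust
  obtain ⟨t, ht⟩ := host
  obtain ⟨w, hw, hwE, hwo, -⟩ := exists_push hs ho hoE (span_of_aStamp hs ht)
  obtain ⟨t', hwt, hot⟩ := id hwo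
  rw [ht] at hot
  cases hot
  rcases hpop u w o hu hw ho huE hwE hoE s t hs₁ hwt (Or.inr hwo) with h | h | h
  · exact Or.inl ⟨s, t, hs₁, ht, Or.inl h⟩
  · exact Or.inr ⟨t, s, ht, hs₁, h⟩
  · exact Or.inl ⟨s, t, hs₁, ht, Or.inr h⟩

/-- A pop that fails to miss a push with a larger abstract timestamp was preceded by a pop of
that push. -/
theorem exists_pop_of_not_miss {o u : Ev} (ho : H.IsPop o) (hoE : o ∉ H.elimSet)
    (hu : H.IsPush u) (huE : u ∉ H.elimSet) (hlt : H.AStampLT ll o u) (hm : ¬ H.Miss ll o u) :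
    ∃ p, H.IsPop p ∧ p ∉ H.elimSet ∧ H.SameAStamp u p ∧ ¬ H.SpanEndLT o p := by
  by_contra hcon
  push Not at hcon
  exact hm ⟨ho, hu, hoE, huE, hlt, hcon⟩

theorem spanEndLT_or_of_not_lt (hs : H.StructuralInvariants) {x y : Ev}
    (hx : ∃ a, H.span x = some a) (hy : ∃ b, H.span y = some b) (h : ¬ H.SpanEndLT x y) :
    H.SpanEndLT y x ∨ x = y := by
  obtain ⟨a, ha⟩ := hx
  obtain ⟨b, hb⟩ := hy
  rcases lt_trichotomy a.2 b.2 with hab | hab | hab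
  · exact absurd ⟨a, b, ha, hb, hab⟩ h
  · have := hs.span_end_inj x y a b ha hb hab
    subst this
    exact Or.inr (hs.span_inj x y a ha hb)
  · exact Or.inl ⟨b, a, hb, ha, hab⟩

theorem AStampLT.span_left (hs : H.StructuralInvariants) {x y : Ev} (h : H.AStampLT ll x y) :
    ∃ a, H.span x = some a := by
  obtain ⟨s, t, hx, hy, -⟩ := h
  exact span_of_aStamp hs hx

theorem AStampLT.span_right (hs : H.StructuralInvariants) {x y : Ev} (h : H.AStampLT ll x y) :
    ∃ a, H.span y = some a := by
  obtain ⟨s, t, hx, hy, -⟩ := h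
  exact span_of_aStamp hs hy

/-- The base separability relation between pops. -/
def PopSep (H : History Ev Rep TS Val) (ll : ℕ × TS → ℕ × TS → Prop) (o₂ o₁ : Ev) : Prop :=
  H.AStampLT ll o₁ o₂ ∧ ¬ H.MissUpTo ll o₁ o₂

/-- The push taken by `a` lies above `b` but is not missed by `b`, so some pop of it does not end
after `b`. By uniqueness of ids that pop is `a`. -/
theorem PopSep.spanEndLT (hll : IsStrictOrder (ℕ × TS) ll) (hs : H.StructuralInvariants)
    {a b : Ev} (ha : H.IsPop a) (haE : a ∉ H.elimSet) (hb : H.IsPop b) (hbE : b ∉ H.elimSet)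
    (h : H.PopSep ll a b) : H.SpanEndLT a b := by
  obtain ⟨hlt, hm⟩ := h
  obtain ⟨u, hu, huE, hua, -⟩ := exists_push hs ha haE (hlt.span_right hs)
  obtain ⟨p, hp, hpE, hup, hend⟩ := exists_pop_of_not_miss hb hbE hu huE
    (hlt.trans_le hll hua.symm.le) fun hmiss => hm ⟨u, huE, hmiss, hua.le⟩
  have hpa : p = a := hs.pop_id_inj _ _ hp ha (hup.sameId.symm.trans hua.sameId)
  subst hpa
  rcases spanEndLT_or_of_not_lt hs (hlt.span_left hs) (hlt.span_right hs) hend with h | rfl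
  · exact h
  · exact absurd hlt (AStampLT.irrefl hll _)

/-- Let `u` be a push missed by `b`. If `u` were at most `a`, then `b` would miss up to `a`; so `a`
is below `u`. Every pop of `u` ends after `b`, hence after `a`. -/
theorem PopSep.missUpTo (hll : IsStrictOrder (ℕ × TS) ll) (hpop : H.PopTotal ll)
    (hs : H.StructuralInvariants) {a b x : Ev} (ha : H.IsPop a) (haE : a ∉ H.elimSet)
    (hb : H.IsPop b) (hbE : b ∉ H.elimSet) (h : H.PopSep ll a b) (hbx : H.MissUpTo ll b x) :
    H.MissUpTo ll a x := by
  obtain ⟨u, huE, hmiss, hle⟩ := hbx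
  have hend := h.spanEndLT hll hs ha haE hb hbE
  refine ⟨u, huE, ?_, hle⟩
  have hlt : H.AStampLT ll a u := by
    rcases push_le_pop_or_lt hs hpop hmiss.2.1 huE
      (aStamp_of_span hs (hmiss.2.2.2.2.1.span_right hs)) ha haE
      (aStamp_of_span hs (h.1.span_right hs)) with h' | h'
    · exact absurd ⟨u, huE, hmiss, h'⟩ h.2
    · exact h'
  exact ⟨ha, hmiss.2.1, haE, huE, hlt, fun p hp hpE hup =>
    hend.trans (hmiss.2.2.2.2.2 p hp hpE hup)⟩

theorem PopSep.trans (hll : IsStrictOrder (ℕ × TS) ll) (hpop : H.PopTotal ll)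
    (hs : H.StructuralInvariants) {a b c : Ev} (hb : H.IsPop b) (hbE : b ∉ H.elimSet)
    (hc : H.IsPop c) (hcE : c ∉ H.elimSet)
    (hab : H.PopSep ll a b) (hbc : H.PopSep ll b c) : H.PopSep ll a c :=
  ⟨hbc.1.trans_le hll hab.1.le, fun hm => hab.2 (hbc.missUpTo hll hpop hs hb hbE hc hcE hm)⟩

/-- This is the one composition whose shape is not determined in advance: it depends on how the
missed push `u` compares with `c`, and how the push `w` taken by `c` compares with `a`. -/
theorem MissUpTo.trans_popSep (hll : IsStrictOrder (ℕ × TS) ll) (hpop : H.PopTotal ll)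
    (hs : H.StructuralInvariants) {a b c : Ev} (ha : H.IsPop a) (haE : a ∉ H.elimSet)
    (hc : H.IsPop c) (hcE : c ∉ H.elimSet)
    (hab : H.MissUpTo ll a b) (hbc : H.PopSep ll b c) :
    H.MissUpTo ll a c ∨ H.PopSep ll a c := by
  have hab' := hab.lt hll
  obtain ⟨u, huE, hmiss, hle⟩ := id hab
  have hcst := aStamp_of_span hs (hbc.1.span_left hs)
  rcases push_le_pop_or_lt hs hpop hmiss.2.1 huE
    (aStamp_of_span hs (hmiss.2.2.2.2.1.span_right hs)) hc hcE hcst with huc | hcu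
  · exact Or.inl ⟨u, huE, hmiss, huc⟩
  obtain ⟨w, hw, hwE, hwc, -⟩ := exists_push hs hc hcE (hbc.1.span_left hs)
  obtain ⟨s, hws, -⟩ := id hwc
  rcases push_le_pop_or_lt hs hpop hw hwE ⟨s, hws⟩ ha haE
    (aStamp_of_span hs (hab'.span_left hs)) with hwa | haw
  · have hca : H.AStampLE ll c a := AStampLE.trans hll hwc.symm.le hwa
    rcases hca.lt_or_same with hca | hca
    · exact Or.inr ⟨hca, fun hm => hbc.2 (hm.mono hll hab'.le)⟩
    · have : c = a := hs.pop_id_inj _ _ hc ha hca.sameId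
      subst this
      exact absurd hab hbc.2
  -- If `a` did not miss up to `c`, then `c` would end before `a`, which ends before every pop of
  -- `u`. But `c` is below `u` without missing it, so some pop of `u` does not end after `c`.
  · left
    by_contra hm
    have hac : H.AStampLT ll a c := haw.trans_le hll hwc.le
    have hend : H.SpanEndLT c a := PopSep.spanEndLT hll hs hc hcE ha haE ⟨hac, hm⟩
    obtain ⟨p, hp, hpE, hup, hnot⟩ := exists_pop_of_not_miss hc hcE hmiss.2.1 huE hcu
      fun h => hbc.2 ⟨u, huE, h, hle⟩
    exact hnot (hend.trans (hmiss.2.2.2.2.2 p hp hpE hup))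

/-- The transitive closure of the base constraint relation, in explicit form. -/
def BaseReach (H : History Ev Rep TS Val) (ll : ℕ × TS → ℕ × TS → Prop) (x y : Ev) : Prop :=
  x ∉ H.elimSet ∧ y ∉ H.elimSet ∧
    ((H.IsPush x ∧ H.IsPush y ∧ H.AStampLT ll x y) ∨
     (H.IsPop x ∧ H.IsPush y ∧ H.MissUpTo ll x y) ∨
     (H.IsPop x ∧ H.IsPop y ∧ (H.MissUpTo ll x y ∨ H.PopSep ll x y)) ∨
     (H.IsPush x ∧ H.IsPop y ∧ ∃ o, H.IsPop o ∧ o ∉ H.elimSet ∧ H.AStampLE ll x o ∧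
        (o = y ∨ H.PopSep ll o y)))

theorem baseReach_of_step {x y : Ev} (h : H.BaseVis x y ∨ H.BaseSep ll x y) :
    H.BaseReach ll x y := by
  rcases h with ⟨hx, hy, hxE, hyE, h⟩ | ⟨hxE, hyE, ⟨hx, hy, h⟩ | ⟨hx, hy, h⟩ | ⟨hx, hy, h⟩⟩
  · exact ⟨hxE, hyE, Or.inr (Or.inr (Or.inr ⟨hx, hy, y, hy, hyE, h.le, Or.inl rfl⟩))⟩
  · exact ⟨hxE, hyE, Or.inl ⟨hx, hy, h⟩⟩
  · exact ⟨hxE, hyE, Or.inr (Or.inl ⟨hx, hy, h⟩)⟩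
  · exact ⟨hxE, hyE, Or.inr (Or.inr (Or.inl ⟨hx, hy, Or.inr h⟩))⟩

theorem BaseReach.head (hll : IsStrictOrder (ℕ × TS) ll) (hpop : H.PopTotal ll)
    (hs : H.StructuralInvariants) {x y z : Ev} (h : H.BaseVis x y ∨ H.BaseSep ll x y)
    (hyz : H.BaseReach ll y z) : H.BaseReach ll x z := by
  obtain ⟨hyE, hzE, hyz⟩ := hyz
  rcases h with ⟨hx, hy, hxE, -, h⟩ | ⟨hxE, -, ⟨hx, hy, h⟩ | ⟨hx, hy, h⟩ | ⟨hx, hy, h⟩⟩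
  · refine ⟨hxE, hzE, ?_⟩
    rcases hyz with ⟨hy', -⟩ | ⟨-, hz, hm⟩ | ⟨-, hz, hm | hm⟩ | ⟨hy', -⟩
    · exact absurd hy hy'.not_isPop
    · exact Or.inl ⟨hx, hz, h.le.trans_lt hll (hm.lt hll)⟩
    · exact Or.inr (Or.inr (Or.inr
        ⟨hx, hz, z, hz, hzE, (h.le.trans_lt hll (hm.lt hll)).le, Or.inl rfl⟩))
    · exact Or.inr (Or.inr (Or.inr ⟨hx, hz, y, hy, hyE, h.le, Or.inr hm⟩))
    · exact absurd hy hy'.not_isPop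
  · refine ⟨hxE, hzE, ?_⟩
    rcases hyz with ⟨-, hz, hlt⟩ | ⟨hy', -⟩ | ⟨hy', -⟩ | ⟨-, hz, o, ho, hoE, hle, hoz⟩
    · exact Or.inl ⟨hx, hz, h.trans_le hll hlt.le⟩
    · exact absurd hy' hy.not_isPop
    · exact absurd hy' hy.not_isPop
    · exact Or.inr (Or.inr (Or.inr ⟨hx, hz, o, ho, hoE, h.le.trans hll hle, hoz⟩))
  · refine ⟨hxE, hzE, ?_⟩
    rcases hyz with ⟨-, hz, hlt⟩ | ⟨hy', -⟩ | ⟨hy', -⟩ | ⟨-, hz, o, ho, hoE, hle, rfl | hoz⟩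
    · exact Or.inr (Or.inl ⟨hx, hz, h.mono hll hlt.le⟩)
    · exact absurd hy' hy.not_isPop
    · exact absurd hy' hy.not_isPop
    · exact Or.inr (Or.inr (Or.inl ⟨hx, hz, Or.inl (h.mono hll hle)⟩))
    · exact Or.inr (Or.inr (Or.inl ⟨hx, hz,
        (h.mono hll hle).trans_popSep hll hpop hs hx hxE hz hzE hoz⟩))
  · refine ⟨hxE, hzE, ?_⟩
    have h' : H.PopSep ll x y := h
    rcases hyz with ⟨hy', -⟩ | ⟨-, hz, hm⟩ | ⟨-, hz, hm | hm⟩ | ⟨hy', -⟩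
    · exact absurd hy hy'.not_isPop
    · exact Or.inr (Or.inl ⟨hx, hz, h'.missUpTo hll hpop hs hx hxE hy hyE hm⟩)
    · exact Or.inr (Or.inr (Or.inl
        ⟨hx, hz, Or.inl (h'.missUpTo hll hpop hs hx hxE hy hyE hm)⟩))
    · exact Or.inr (Or.inr (Or.inl
        ⟨hx, hz, Or.inr (h'.trans hll hpop hs hy hyE hz hzE hm)⟩))
    · exact absurd hy hy'.not_isPop

theorem baseReach_of_transGen (hll : IsStrictOrder (ℕ × TS) ll) (hpop : H.PopTotal ll)
    (hs : H.StructuralInvariants) {x y : Ev}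
    (h : Relation.TransGen (fun a b => H.BaseVis a b ∨ H.BaseSep ll a b) x y) :
    H.BaseReach ll x y := by
  induction h using Relation.TransGen.head_induction_on with
  | single h => exact baseReach_of_step h
  | head h _ ih => exact ih.head hll hpop hs h

theorem BaseReach.irrefl (hll : IsStrictOrder (ℕ × TS) ll) (x : Ev) : ¬ H.BaseReach ll x x := by
  rintro ⟨-, -, ⟨-, -, h⟩ | ⟨h, h', -⟩ | ⟨-, -, h | h⟩ | ⟨h, h', -⟩⟩
  · exact AStampLT.irrefl hll x h
  · exact h'.not_isPop h
  · exact AStampLT.irrefl hll x (h.lt hll)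
  · exact AStampLT.irrefl hll x h.1
  · exact h.not_isPop h'

/-- If `u` preceded `o`, it would precede the missed push `w`, which starts after `o` does. Then `u`
is below `w` by `disjoint_push`, while `w` is at most `u`. -/
theorem MissUpTo.not_spanPrecedes (hll : IsStrictOrder (ℕ × TS) ll)
    (hkey : H.KeyInvariants ll) {o u : Ev} (h : H.MissUpTo ll o u) (hu : H.IsPush u) :
    ¬ H.SpanPrecedes u o := by
  intro hpre
  obtain ⟨w, hwE, hmiss, hle⟩ := h
  exact AStampLT.irrefl hll w (hle.trans_lt hll (hkey.disjoint_push u w hu hmiss.2.1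
    (hpre.trans_start (hkey.misses_start_late o w hmiss))))

theorem BaseReach.not_returnsBefore (hll : IsStrictOrder (ℕ × TS) ll)
    (hkey : H.KeyInvariants ll) (hs : H.StructuralInvariants) {x y : Ev}
    (h : H.BaseReach ll x y) : ¬ H.ReturnsBefore y x := by
  intro hrb
  obtain ⟨hxE, hyE, ⟨hx, hy, h⟩ | ⟨hx, hy, h⟩ | ⟨hx, hy, h | h⟩ |
    ⟨hx, hy, o, ho, hoE, hle, hoy⟩⟩ := h
  · exact AStampLT.irrefl hll x (h.trans_le hll
      (hkey.disjoint_push y x hy hx (hrb.spanPrecedes hs (h.span_left hs))).le)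
  · exact h.not_spanPrecedes hll hkey hy (hrb.spanPrecedes hs ((h.lt hll).span_left hs))
  · have hpre := hrb.spanPrecedes hs ((h.lt hll).span_left hs)
    obtain ⟨u, hu, huE, huy, hpre'⟩ := exists_push hs hy hyE ((h.lt hll).span_right hs)
    exact (h.mono hll huy.symm.le).not_spanPrecedes hll hkey hu (hpre'.trans hs hpre)
  · exact SpanPrecedes.irrefl hs x ((h.spanEndLT hll hs hx hxE hy hyE).trans_precedes
      (hrb.spanPrecedes hs (h.1.span_right hs)))
  · obtain ⟨s, t, hxs, hot, -⟩ := id hle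
    have hpre := hrb.spanPrecedes hs (span_of_aStamp hs hxs)
    obtain ⟨u, hu, huE, huo, hpre'⟩ := exists_push hs ho hoE (span_of_aStamp hs hot)
    -- The push `u` taken by the intermediate pop `o` precedes `o`, which ends no later than `y`,
    -- and `y` returns before `x`.
    have hux : H.SpanPrecedes u x := by
      rcases hoy with rfl | hoy
      · exact hpre'.trans hs hpre
      · exact hpre'.trans hs ((hoy.spanEndLT hll hs ho hoE hy hyE).trans_precedes hpre)
    exact AStampLT.irrefl hll x (hle.trans_lt hll
      (huo.symm.le.trans_lt hll (hkey.disjoint_push u x hu hx hux)))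

/-! ### Adding an elimination pair -/

/-- The constraint relation `r` admits no future dependences. -/
def NoFuture (H : History Ev Rep TS Val) (r : Ev → Ev → Prop) : Prop :=
  ∀ x y, Relation.TransGen r x y → ¬ (y = x ∨ H.ReturnsBefore y x)

/-- Some event reachable from `x` returns before one of `u` and `o`. -/
def BeforePair (H : History Ev Rep TS Val) (r : Ev → Ev → Prop) (u o x : Ev) : Prop :=
  ∃ z, Relation.ReflTransGen r x z ∧ (H.ReturnsBefore z u ∨ H.ReturnsBefore z o)

/-- Uniqueness of ids pins the coupled event `c` to `o`. Together with `be_pop_iff` this makes the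
insertion test the same for both members of a pair. -/
theorem Elim.be_push_iff (hs : H.StructuralInvariants) {r : Ev → Ev → Prop} {u o x : Ev}
    (h : H.Elim u o) : H.BE r x u ↔ H.BeforePair r u o x := by
  constructor
  · rintro ⟨-, z, hz, ⟨c, hc | hc, hzc⟩ | hzu⟩
    · rw [hc.eq_of_push hs h] at hzc
      exact ⟨z, hz, Or.inr hzc⟩
    · exact absurd hc.2.1 h.1.not_isPop
    · exact ⟨z, hz, Or.inl hzu⟩
  · rintro ⟨z, hz, hzu | hzo⟩
    · exact ⟨⟨o, Or.inl h⟩, z, hz, Or.inr hzu⟩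
    · exact ⟨⟨o, Or.inl h⟩, z, hz, Or.inl ⟨o, Or.inl h, hzo⟩⟩

theorem Elim.be_pop_iff (hs : H.StructuralInvariants) {r : Ev → Ev → Prop} {u o x : Ev}
    (h : H.Elim u o) : H.BE r x o ↔ H.BeforePair r u o x := by
  constructor
  · rintro ⟨-, z, hz, ⟨c, hc | hc, hzc⟩ | hzo⟩
    · exact absurd h.2.1 hc.1.not_isPop
    · rw [hc.eq_of_pop hs h] at hzc
      exact ⟨z, hz, Or.inl hzc⟩
    · exact ⟨z, hz, Or.inr hzo⟩
  · rintro ⟨z, hz, hzu | hzo⟩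
    · exact ⟨⟨u, Or.inr h⟩, z, hz, Or.inl ⟨u, Or.inr h, hzu⟩⟩
    · exact ⟨⟨u, Or.inr h⟩, z, hz, Or.inr hzo⟩

theorem BeforePair.of_reach {r : Ev → Ev → Prop} {u o x y : Ev}
    (h : H.BeforePair r u o y) (hxy : Relation.ReflTransGen r x y) : H.BeforePair r u o x := by
  obtain ⟨z, hz, hzp⟩ := h
  exact ⟨z, hxy.trans hz, hzp⟩

/-- If `y` returns before an event `x` that comes before a pair, then `y` returns before an
event of that pair. -/
theorem BeforePair.returnsBefore_trans {r : Ev → Ev → Prop} (hr : H.NoFuture r) {u o x y : Ev}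
    (hx : H.BeforePair r u o x) (hyx : H.ReturnsBefore y x) :
    H.ReturnsBefore y u ∨ H.ReturnsBefore y o := by
  obtain ⟨z, hxz, hz⟩ := hx
  obtain ⟨t, ht, htx⟩ := hyx
  -- If `z` ended no later than `y`, it would return before `x`, although it is reachable from `x`.
  have key : ∀ t', H.endTime z = some t' → t < t' := by
    intro t' ht'
    rcases Relation.reflTransGen_iff_eq_or_transGen.1 hxz with rfl | hxz
    · exact htx.trans_le (H.start_le_end _ _ ht')
    · by_contra hcon
      exact hr _ _ hxz (Or.inr ⟨t', ht', by omega⟩)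
  rcases hz with ⟨t', ht', h⟩ | ⟨t', ht', h⟩
  · exact Or.inl ⟨t, ht, (key t' ht').trans h⟩
  · exact Or.inr ⟨t, ht, (key t' ht').trans h⟩

theorem not_returnsBefore_self (x : Ev) : ¬ H.ReturnsBefore x x := by
  rintro ⟨t, ht, hlt⟩
  have := H.start_le_end x t ht
  omega

/-- The result of extending a constraint relation `r` on the complement of `F` by the elimination
pair of `u` and `o`. -/
def ExtendByPair (H : History Ev Rep TS Val) (r : Ev → Ev → Prop) (F : Set Ev) (u o : Ev)
    (x y : Ev) : Prop :=
  (x = u ∧ y = o) ∨ (x ∉ F ∧ (y = u ∨ y = o) ∧ H.BeforePair r u o x) ∨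
    ((x = u ∨ x = o) ∧ y ∉ F ∧ ¬ H.BeforePair r u o y) ∨ r x y

theorem noFuture_extendByPair (hs : H.StructuralInvariants) {r : Ev → Ev → Prop} {F : Set Ev}
    {u o : Ev} (hr : H.NoFuture r) (hdom : ∀ x y, r x y → x ∉ F ∧ y ∉ F)
    (huo : H.Elim u o) (hu : u ∈ F) (ho : o ∈ F) :
    H.NoFuture (H.ExtendByPair r F u o) := by
  have hne : o ≠ u := huo.2.1.ne_push huo.1
  have hmem : ∀ {x}, x = u ∨ x = o → x ∈ F := by
    rintro x (rfl | rfl) <;> assumption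
  -- A path visits the pair at most once: it enters only from an event satisfying `BeforePair`,
  -- leaves only to one that does not, and failure of `BeforePair` persists along `r`.
  have normal : ∀ x y, Relation.TransGen (H.ExtendByPair r F u o) x y →
      (x = u ∧ y = o) ∨ (x ∉ F ∧ (y = u ∨ y = o) ∧ H.BeforePair r u o x) ∨
      ((x = u ∨ x = o) ∧ y ∉ F ∧ ¬ H.BeforePair r u o y) ∨
      (x ∉ F ∧ y ∉ F ∧
        (Relation.TransGen r x y ∨ H.BeforePair r u o x ∧ ¬ H.BeforePair r u o y)) := by
    intro x y hxy
    induction hxy with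
    | single h =>
      rcases h with h | h | h | h
      · exact Or.inl h
      · exact Or.inr (Or.inl h)
      · exact Or.inr (Or.inr (Or.inl h))
      · exact Or.inr (Or.inr (Or.inr ⟨(hdom _ _ h).1, (hdom _ _ h).2, Or.inl (.single h)⟩))
    | @tail b c _ hbc ih =>
      rcases ih with ⟨rfl, rfl⟩ | ⟨hx, hb, hxb⟩ | ⟨hx, hb, hnb⟩ | ⟨hx, hb, hxb⟩
      · rcases hbc with ⟨h, -⟩ | ⟨h, -⟩ | ⟨-, hc, hnc⟩ | h
        · exact absurd h hne
        · exact absurd ho h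
        · exact Or.inr (Or.inr (Or.inl ⟨Or.inl rfl, hc, hnc⟩))
        · exact absurd ho (hdom _ _ h).1
      · rcases hbc with ⟨-, hc⟩ | ⟨h, -⟩ | ⟨-, hc, hnc⟩ | h
        · exact Or.inr (Or.inl ⟨hx, Or.inr hc, hxb⟩)
        · exact absurd (hmem hb) h
        · exact Or.inr (Or.inr (Or.inr ⟨hx, hc, Or.inr ⟨hxb, hnc⟩⟩))
        · exact absurd (hmem hb) (hdom _ _ h).1
      · rcases hbc with ⟨h, -⟩ | ⟨-, -, h⟩ | ⟨h, -⟩ | h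
        · exact absurd (hmem (Or.inl h)) hb
        · exact absurd h hnb
        · exact absurd (hmem h) hb
        · exact Or.inr (Or.inr (Or.inl ⟨hx, (hdom _ _ h).2, fun hc =>
            hnb (hc.of_reach (.single h))⟩))
      · rcases hbc with ⟨h, -⟩ | ⟨-, hc, h⟩ | ⟨h, -⟩ | h
        · exact absurd (hmem (Or.inl h)) hb
        · refine Or.inr (Or.inl ⟨hx, hc, ?_⟩)
          rcases hxb with hxb | hxb
          · exact h.of_reach hxb.to_reflTransGen
          · exact hxb.1
        · exact absurd (hmem h) hb
        · refine Or.inr (Or.inr (Or.inr ⟨hx, (hdom _ _ h).2, ?_⟩))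
          rcases hxb with hxb | ⟨hxb, hnb⟩
          · exact Or.inl (hxb.tail h)
          · exact Or.inr ⟨hxb, fun hc => hnb (hc.of_reach (.single h))⟩
  intro x y hxy
  rcases normal x y hxy with ⟨rfl, rfl⟩ | ⟨hx, hy, hbx⟩ | ⟨hx, hy, hby⟩ | ⟨hx, hy, h | ⟨hbx, hby⟩⟩
  · rintro (h | h)
    · exact hne h
    · exact huo.not_returnsBefore_swap hs h
  · rintro (rfl | h)
    · exact hx (hmem hy)
    · rcases hy with rfl | rfl <;> rcases hbx.returnsBefore_trans hr h with h' | h'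
      · exact not_returnsBefore_self _ h'
      · exact huo.2.2.2 h'
      · exact huo.not_returnsBefore_swap hs h'
      · exact not_returnsBefore_self _ h'
  · rintro (rfl | h)
    · exact hy (hmem hx)
    · rcases hx with rfl | rfl
      · exact hby ⟨y, .refl, Or.inl h⟩
      · exact hby ⟨y, .refl, Or.inr h⟩
  · exact hr _ _ h
  · rintro (rfl | h)
    · exact hby hbx
    -- If `y` returned before `x`, it would return before a member of the pair, and so lie on the
    -- wrong side of it.
    · exact hby ⟨y, .refl, hbx.returnsBefore_trans hr h⟩

/-! ### The enumerated elimination pairs -/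

section Enumeration

variable {n : ℕ} {enum : Fin n → Ev × Ev}

theorem IsElimEnum.elim (henum : H.IsElimEnum enum) (i : Fin n) :
    H.Elim (enum i).1 (enum i).2 :=
  (henum.2 _ _).1 ⟨i, rfl⟩

theorem IsElimEnum.mem_elimSet (henum : H.IsElimEnum enum) {i : ℕ} {x : Ev}
    (hx : x ∈ pairSet enum i) : x ∈ H.elimSet := by
  obtain ⟨hi, rfl | rfl⟩ := hx
  · exact ⟨_, Or.inl (henum.elim _)⟩
  · exact ⟨_, Or.inr (henum.elim _)⟩

theorem IsElimEnum.pairSet_disjoint (henum : H.IsElimEnum enum) (hs : H.StructuralInvariants)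
    {i j : ℕ} {x : Ev} (hi : x ∈ pairSet enum i) (hj : x ∈ pairSet enum j) : i = j := by
  obtain ⟨hin, hi⟩ := hi
  obtain ⟨hjn, hj⟩ := hj
  have ei := henum.elim ⟨i, hin⟩
  have ej := henum.elim ⟨j, hjn⟩
  suffices enum ⟨i, hin⟩ = enum ⟨j, hjn⟩ by simpa using henum.1 this
  rcases hi with hi | hi <;> rcases hj with hj | hj
  · rw [← hi] at ei
    rw [← hj] at ej
    exact Prod.ext (hi.symm.trans hj) (ei.eq_of_push hs ej)
  · exact absurd (hi ▸ hj ▸ ej.2.1) (ei.1.not_isPop)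
  · exact absurd (hj ▸ hi ▸ ei.2.1) (ej.1.not_isPop)
  · rw [← hi] at ei
    rw [← hj] at ej
    exact Prod.ext (ei.eq_of_pop hs ej) (hi.symm.trans hj)

theorem mem_elimSetFrom {i : ℕ} {x : Ev} :
    x ∈ H.elimSetFrom enum i ↔ x ∈ H.elimSet ∧ ∀ j < i, x ∉ pairSet enum j := by
  induction i with
  | zero => simp [elimSetFrom]
  | succ i ih =>
    simp only [elimSetFrom, Set.mem_sdiff, ih, Nat.lt_succ_iff_lt_or_eq]
    grind

theorem IsElimEnum.pairSet_subset (henum : H.IsElimEnum enum) (hs : H.StructuralInvariants)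
    {i : ℕ} {x : Ev} (hx : x ∈ pairSet enum i) : x ∈ H.elimSetFrom enum i :=
  mem_elimSetFrom.2 ⟨henum.mem_elimSet hx, fun _ hj hxj =>
    hj.ne (henum.pairSet_disjoint hs hxj hx)⟩

theorem elimSetFrom_anti {i j : ℕ} (hij : i ≤ j) {x : Ev} (hx : x ∉ H.elimSetFrom enum i) :
    x ∉ H.elimSetFrom enum j := fun h =>
  hx (mem_elimSetFrom.2 ⟨(mem_elimSetFrom.1 h).1, fun k hk =>
    (mem_elimSetFrom.1 h).2 k (hk.trans_le hij)⟩)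

theorem not_mem_elimSetFrom_of_mem_pairSet {i j : ℕ} (hij : i < j) {x : Ev}
    (hx : x ∈ pairSet enum i) : x ∉ H.elimSetFrom enum j :=
  fun h => (mem_elimSetFrom.1 h).2 i hij hx

/-- The constraint relation when the first `i` elimination pairs have been included. -/
def constraintAt (H : History Ev Rep TS Val) (ll : ℕ × TS → ℕ × TS → Prop)
    (enum : Fin n → Ev × Ev) (i : ℕ) (x y : Ev) : Prop :=
  H.visAt enum i x y ∨ H.sepAt ll enum i x y

theorem IsElimEnum.constraintAt_succ (henum : H.IsElimEnum enum) (hs : H.StructuralInvariants)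
    {i : ℕ} (hi : i < n) {x y : Ev} (h : H.constraintAt ll enum (i + 1) x y) :
    H.ExtendByPair (H.constraintAt ll enum i) (H.elimSetFrom enum i)
      (enum ⟨i, hi⟩).1 (enum ⟨i, hi⟩).2 x y := by
  have he := henum.elim ⟨i, hi⟩
  rcases h with (h | ⟨_, h⟩) | ⟨hx, ⟨_, hy⟩, h⟩ | ⟨⟨_, hx⟩, hy, h⟩ | h
  · exact Or.inr (Or.inr (Or.inr (Or.inl h)))
  · exact Or.inl (by simp [h])
  · refine Or.inr (Or.inl ⟨hx, hy, ?_⟩)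
    rcases hy with rfl | rfl
    · exact (he.be_push_iff hs).1 h
    · exact (he.be_pop_iff hs).1 h
  · refine Or.inr (Or.inr (Or.inl ⟨hx, hy, fun hb => h ?_⟩))
    rcases hx with rfl | rfl
    · exact (he.be_push_iff hs).2 hb
    · exact (he.be_pop_iff hs).2 hb
  · exact Or.inr (Or.inr (Or.inr (Or.inr h)))

/-- Needed so that a pair about to be inserted has no incident edges yet. -/
theorem IsElimEnum.constraintAt_dom (henum : H.IsElimEnum enum) (hs : H.StructuralInvariants)
    {i : ℕ} (hi : i ≤ n) : ∀ {x y : Ev}, H.constraintAt ll enum i x y →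
      x ∉ H.elimSetFrom enum i ∧ y ∉ H.elimSetFrom enum i := by
  induction i with
  | zero =>
    rintro x y (h | h)
    · exact ⟨h.2.2.1, h.2.2.2.1⟩
    · exact ⟨h.1, h.2.1⟩
  | succ i ih =>
    intro x y h
    have hpair : ∀ {z}, z = (enum ⟨i, hi⟩).1 ∨ z = (enum ⟨i, hi⟩).2 →
        z ∉ H.elimSetFrom enum (i + 1) := fun hz =>
      not_mem_elimSetFrom_of_mem_pairSet i.lt_succ_self ⟨hi, hz⟩
    rcases henum.constraintAt_succ hs hi h with ⟨hx, hy⟩ | ⟨hx, hy, -⟩ | ⟨hx, hy, -⟩ | h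
    · exact ⟨hpair (Or.inl hx), hpair (Or.inr hy)⟩
    · exact ⟨elimSetFrom_anti i.le_succ hx, hpair hy⟩
    · exact ⟨hpair hx, elimSetFrom_anti i.le_succ hy⟩
    · have := ih (Nat.le_of_succ_le hi) h
      exact ⟨elimSetFrom_anti i.le_succ this.1, elimSetFrom_anti i.le_succ this.2⟩

theorem NoFuture.mono {r r' : Ev → Ev → Prop} (h : H.NoFuture r') (hle : ∀ x y, r x y → r' x y) :
    H.NoFuture r := fun x y hxy => h x y (Relation.TransGen.mono hle _ _ hxy)

theorem noFuture_constraintAt (hll : IsStrictOrder (ℕ × TS) ll) (hpop : H.PopTotal ll)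
    (hkey : H.KeyInvariants ll) (hs : H.StructuralInvariants) (henum : H.IsElimEnum enum)
    {i : ℕ} (hi : i ≤ n) : H.NoFuture (H.constraintAt ll enum i) := by
  induction i with
  | zero =>
    intro x y h
    have hreach := baseReach_of_transGen hll hpop hs h
    rintro (rfl | hrb)
    · exact BaseReach.irrefl hll _ hreach
    · exact hreach.not_returnsBefore hll hkey hs hrb
  | succ i ih =>
    have hi' : i ≤ n := Nat.le_of_succ_le hi
    exact (noFuture_extendByPair hs (ih hi') (fun _ _ h => henum.constraintAt_dom hs hi' h)
      (henum.elim ⟨i, hi⟩) (henum.pairSet_subset hs ⟨hi, Or.inl rfl⟩)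
      (henum.pairSet_subset hs ⟨hi, Or.inr rfl⟩)).mono
        fun _ _ h => henum.constraintAt_succ hs hi h

/-- An event outside the elimination pairs from which some event can be reached has a span. -/
theorem span_of_constraintAt (hll : IsStrictOrder (ℕ × TS) ll) (hs : H.StructuralInvariants)
    (henum : H.IsElimEnum enum) {i : ℕ} (hi : i ≤ n) {x : Ev} (hxE : x ∉ H.elimSet) :
    ∀ {y}, H.constraintAt ll enum i x y → ∃ a, H.span x = some a := by
  induction i with
  | zero =>
    rintro y (⟨-, -, -, -, s, hs', -⟩ | ⟨-, -, ⟨-, -, h⟩ | ⟨-, -, h⟩ | ⟨-, -, h, -⟩⟩)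
    · exact span_of_aStamp hs hs'
    · exact h.span_left hs
    · exact (h.lt hll).span_left hs
    · exact h.span_right hs
  | succ i ih =>
    intro y h
    have hmem : ¬ (x = (enum ⟨i, hi⟩).1 ∨ x = (enum ⟨i, hi⟩).2) := fun h =>
      hxE (henum.mem_elimSet ⟨hi, h⟩)
    rcases henum.constraintAt_succ hs hi h with ⟨hx, -⟩ | ⟨-, -, z, hxz, hz⟩ | ⟨hx, -⟩ | h
    · exact absurd (Or.inl hx) hmem
    -- Either the path witnessing `BE` is trivial and `x` itself has terminated, or its first step
    -- is an edge out of `x` at the previous level.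
    · rcases hxz.cases_head with rfl | ⟨w, hxw, -⟩
      · obtain ⟨t, ht, -⟩ | ⟨t, ht, -⟩ := hz <;> exact (hs.terminated_span x ⟨t, ht⟩).1
      · exact ih (Nat.le_of_succ_le hi) hxw
    · exact absurd hx hmem
    · exact ih (Nat.le_of_succ_le hi) h

theorem span_of_closed (hll : IsStrictOrder (ℕ × TS) ll) (hs : H.StructuralInvariants)
    (henum : H.IsElimEnum enum) {x : Ev} (hxE : x ∉ H.elimSet)
    (hx : H.Closed (H.vis enum) (H.sep ll enum) x) : ∃ a, H.span x = some a := by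
  obtain ⟨t, ht, hxt⟩ := hx
  rcases hxt.cases_head with rfl | ⟨w, hxw, -⟩
  · exact (hs.terminated_span x ht).1
  · exact span_of_constraintAt hll hs henum le_rfl hxE hxw

theorem visAt_mono {i j : ℕ} (hij : i ≤ j) {x y : Ev} (h : H.visAt enum i x y) :
    H.visAt enum j x y := by
  induction hij with
  | refl => exact h
  | step _ ih => exact Or.inl ih

theorem sepAt_mono {i j : ℕ} (hij : i ≤ j) {x y : Ev} (h : H.sepAt ll enum i x y) :
    H.sepAt ll enum j x y := by
  induction hij with
  | refl => exact h
  | step _ ih => exact Or.inr (Or.inr ih)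

theorem vis_iff (henum : H.IsElimEnum enum) {u o : Ev} :
    H.vis enum u o ↔ H.BaseVis u o ∨ H.Elim u o := by
  constructor
  · suffices ∀ i, H.visAt enum i u o → H.BaseVis u o ∨ H.Elim u o from this n
    intro i
    induction i with
    | zero => exact Or.inl
    | succ i ih =>
      rintro (h | ⟨hi, h⟩)
      · exact ih h
      · exact Or.inr ((henum.2 u o).1 ⟨_, h⟩)
  · rintro (h | h)
    · exact visAt_mono (Nat.zero_le n) h
    · obtain ⟨i, hi⟩ := (henum.2 u o).2 h
      exact visAt_mono (Nat.succ_le_of_lt i.2) (Or.inr ⟨i.2, hi⟩)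

theorem sep_of_baseSep {x y : Ev} (h : H.BaseSep ll x y) : H.sep ll enum x y :=
  sepAt_mono (Nat.zero_le n) h

/-- An event that is present when an elimination pair is added is separated from both events of
the pair. -/
theorem sep_pair (hs : H.StructuralInvariants) (henum : H.IsElimEnum enum) {u o x : Ev} {i : Fin n}
    (hi : enum i = (u, o)) (hx : x ∉ H.elimSetFrom enum i) :
    (H.sep ll enum x u ∧ H.sep ll enum x o) ∨ (H.sep ll enum u x ∧ H.sep ll enum o x) := by
  have he : H.Elim u o := (henum.2 u o).1 ⟨i, hi⟩
  have hu : u ∈ pairSet enum i := ⟨i.2, Or.inl (by simp [hi])⟩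
  have ho : o ∈ pairSet enum i := ⟨i.2, Or.inr (by simp [hi])⟩
  have lift : ∀ {a b}, H.sepAt ll enum (i + 1) a b → H.sep ll enum a b :=
    fun h => sepAt_mono (Nat.succ_le_of_lt i.2) h
  by_cases hb : H.BeforePair (H.constraintAt ll enum i) u o x
  · exact Or.inl ⟨lift (Or.inl ⟨hx, hu, (he.be_push_iff hs).2 hb⟩),
      lift (Or.inl ⟨hx, ho, (he.be_pop_iff hs).2 hb⟩)⟩
  · exact Or.inr ⟨lift (Or.inr (Or.inl ⟨hu, hx, fun h => hb ((he.be_push_iff hs).1 h)⟩)),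
      lift (Or.inr (Or.inl ⟨ho, hx, fun h => hb ((he.be_pop_iff hs).1 h)⟩))⟩

/-! ### Concurrent LIFO and return values -/

theorem sameId_of_vis (henum : H.IsElimEnum enum) {u o : Ev} (h : H.vis enum u o) :
    H.SameId u o := by
  rcases (vis_iff henum).1 h with h | h
  · exact h.2.2.2.2.sameId
  · exact h.2.2.1

theorem exists_enum_of_push (henum : H.IsElimEnum enum) {u : Ev} (hu : H.IsPush u)
    (huE : u ∈ H.elimSet) : ∃ (i : Fin n) (o : Ev), enum i = (u, o) := by
  obtain ⟨o, h | h⟩ := huE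
  · obtain ⟨i, hi⟩ := (henum.2 u o).2 h
    exact ⟨i, o, hi⟩
  · exact absurd h.2.1 hu.not_isPop

theorem exists_vis_sep (hll : IsStrictOrder (ℕ × TS) ll) (hpop : H.PopTotal ll)
    (hs : H.StructuralInvariants) (henum : H.IsElimEnum enum) {u₁ o₁ u₂ : Ev}
    (hu₂c : H.Closed (H.vis enum) (H.sep ll enum) u₂) (hu₁ : H.IsPush u₁) (hu₂ : H.IsPush u₂)
    (hvis : H.vis enum u₁ o₁) (hou : ¬ H.sep ll enum o₁ u₂) (hne : u₂ ≠ u₁)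
    (huu : ¬ H.sep ll enum u₂ u₁) :
    ∃ o₂, H.IsPop o₂ ∧ H.vis enum u₂ o₂ ∧ H.sep ll enum o₂ o₁ := by
  by_cases hu₂E : u₂ ∈ H.elimSet
  · obtain ⟨j, o₂, hj⟩ := exists_enum_of_push henum hu₂ hu₂E
    have he₂ : H.Elim u₂ o₂ := (henum.2 _ _).1 ⟨j, hj⟩
    -- If `o₁` is present when the pair of `u₂` is inserted, it goes before or after both members;
    -- before is excluded by `hou`, and after makes `o₂` the required pop.
    have late : o₁ ∉ H.elimSetFrom enum j →
        ∃ o₂, H.IsPop o₂ ∧ H.vis enum u₂ o₂ ∧ H.sep ll enum o₂ o₁ := by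
      intro ho₁
      rcases sep_pair hs henum hj ho₁ with h | h
      · exact absurd h.1 hou
      · exact ⟨o₂, he₂.2.1, (vis_iff henum).2 (Or.inr he₂), h.2⟩
    rcases (vis_iff henum).1 hvis with hb | he₁
    · exact late fun h => hb.2.2.2.1 (mem_elimSetFrom.1 h).1
    · obtain ⟨k, hk⟩ := (henum.2 _ _).2 he₁
      rcases lt_trichotomy k j with hkj | rfl | hkj
      · exact late (not_mem_elimSetFrom_of_mem_pairSet hkj ⟨k.2, Or.inr (by simp [hk])⟩)
      · rw [hj] at hk
        exact absurd (congrArg Prod.fst hk) hne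
      -- Here `u₂` is present when the pair of `u₁` and `o₁` is inserted, so it is separated before
      -- `u₁` or after `o₁`, both excluded.
      · rcases sep_pair (ll := ll) hs henum hk (not_mem_elimSetFrom_of_mem_pairSet hkj
          (x := u₂) ⟨j.2, Or.inl (by simp [hj])⟩) with h | h
        · exact absurd h.1 huu
        · exact absurd h.2 hou
  · rcases (vis_iff henum).1 hvis with ⟨-, ho₁, hu₁E, ho₁E, hsame⟩ | he₁
    · have hst := aStamp_of_span hs (span_of_closed hll hs henum hu₂E hu₂c)
      obtain ⟨s, -, hos⟩ := id hsame
      -- Otherwise `u₂` would be at most `u₁` in timestamp, hence separated before it or equal to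
      -- it.
      have hlt : H.AStampLT ll o₁ u₂ := by
        rcases push_le_pop_or_lt hs hpop hu₂ hu₂E hst ho₁ ho₁E ⟨s, hos⟩ with h | h
        · rcases h.lt_or_same with h | h
          · exact absurd (sep_of_baseSep ⟨hu₂E, hu₁E,
              Or.inl ⟨hu₂, hu₁, h.trans_le hll hsame.symm.le⟩⟩) huu
          · exact absurd (hs.push_id_inj _ _ hu₂ hu₁ (h.sameId.trans hsame.sameId.symm)) hne
        · exact h
      have hm : ¬ H.MissUpTo ll o₁ u₂ := fun h =>
        hou (sep_of_baseSep ⟨ho₁E, hu₂E, Or.inr (Or.inl ⟨ho₁, hu₂, h⟩)⟩)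
      obtain ⟨s₂, hs₂⟩ := hst
      obtain ⟨p, hp, hpE, hup, -⟩ := exists_pop_of_not_miss ho₁ ho₁E hu₂ hu₂E hlt
        fun h => hm ⟨u₂, hu₂E, h, s₂, s₂, hs₂, hs₂, Or.inr rfl⟩
      exact ⟨p, hp, (vis_iff henum).2 (Or.inl ⟨hu₂, hp, hu₂E, hpE, hup⟩),
        sep_of_baseSep ⟨hpE, ho₁E, Or.inr (Or.inr ⟨hp, ho₁, hlt.trans_le hll hup.le,
          fun h => hm (h.mono hll hup.symm.le)⟩)⟩⟩
    · obtain ⟨k, hk⟩ := (henum.2 _ _).2 he₁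
      rcases sep_pair (ll := ll) hs henum hk (fun h => hu₂E (mem_elimSetFrom.1 h).1) with h | h
      · exact absurd h.1 huu
      · exact absurd h.2 hou

theorem nodeId_of_closed (hll : IsStrictOrder (ℕ × TS) ll) (hs : H.StructuralInvariants)
    (henum : H.IsElimEnum enum) {x : Ev} (hx : H.Closed (H.vis enum) (H.sep ll enum) x) :
    ∃ i, H.nodeId x = some i := by
  by_cases hxE : x ∈ H.elimSet
  · obtain ⟨y, h | h⟩ := hxE <;> obtain ⟨i, hi, hi'⟩ := h.2.2.1
    · exact ⟨i, hi⟩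
    · exact ⟨i, hi'⟩
  · exact (hs.span_all x (span_of_closed hll hs henum hxE hx)).2.1

/-- If the two do not eliminate each other, uniqueness of ids keeps `o` out of every pair, and then
the push that `exists_push` gives for `o` must be `u`. -/
theorem vis_of_sameId (hs : H.StructuralInvariants) (henum : H.IsElimEnum enum) {u o : Ev}
    (hu : H.IsPush u) (ho : H.IsPop o) (h : H.SameId u o) : H.vis enum u o := by
  refine (vis_iff henum).2 ?_
  by_cases he : H.Elim u o
  · exact Or.inr he
  have hoE : o ∉ H.elimSet := by
    rintro ⟨y, hy | hy⟩
    · exact hy.1.not_isPop ho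
    · rw [hs.push_id_inj _ _ hy.1 hu (hy.2.2.1.trans h.symm)] at hy
      exact he hy
  obtain ⟨i, -, hi⟩ := id h
  obtain ⟨w, hw, hwE, hwo, -⟩ := exists_push hs ho hoE (hs.pop_id_span o ho ⟨i, hi⟩)
  have hwu : w = u := hs.push_id_inj _ _ hw hu (hwo.sameId.trans h.symm)
  subst hwu
  exact Or.inl ⟨hu, ho, hwE, hoE, hwo⟩

theorem Closed.of_step {V S : Ev → Ev → Prop} {x y : Ev} (hy : H.Closed V S y)
    (h : V x y ∨ S x y) : H.Closed V S x := by
  obtain ⟨t, ht, hyt⟩ := hy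
  exact ⟨t, ht, hyt.head h⟩

theorem exists_post (hll : IsStrictOrder (ℕ × TS) ll) (hs : H.StructuralInvariants)
    (henum : H.IsElimEnum enum) {x : Ev} (hx : H.Closed (H.vis enum) (H.sep ll enum) x) :
    ∃ w, H.Post (H.vis enum) (H.sep ll enum) x w ∧ (H.Terminated x → H.output x = some w) := by
  have hid := nodeId_of_closed hll hs henum hx
  have out : ∀ w, H.effOut x = some w → H.Terminated x → H.output x = some w := by
    intro w hw ht
    obtain ⟨-, v, hv, hv'⟩ := hs.terminated_span x ht
    rw [hv, ← hw, hv']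
  rcases isPush_or_isPop (H := H) x with hp | hp
  · exact ⟨Out.tt, ⟨fun _ => rfl, fun h => absurd h hp.not_isPop⟩, out _ (hs.push_out x hp hid)⟩
  · obtain ⟨u, v, huv, hsame, heff⟩ := hs.pops_take_pushes x hp hid
    have hvis : H.vis enum u x := vis_of_sameId hs henum ⟨v, huv⟩ hp hsame
    refine ⟨Out.val v, ⟨fun h => absurd hp h.not_isPop, fun _ =>
      ⟨fun _ => ⟨u, v, hx.of_step (Or.inl hvis), huv, hvis, rfl⟩, ?_⟩⟩, out _ heff⟩
    -- The output of a pop is always a value here, so the condition for `EMPTY` is vacuous.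
    rintro ⟨⟩

end Enumeration

end History

end TSStack

theorem mainTheorem4 {Ev Rep TS Val : Type*} [LinearOrder Rep]
    (H : TSStack.History Ev Rep TS Val)
    (ll : ℕ × TS → ℕ × TS → Prop) (hll : IsStrictOrder (ℕ × TS) ll) (hpop : H.PopTotal ll)
    (hkey : H.KeyInvariants ll) (hstruct : H.StructuralInvariants)
    {n : ℕ} (enum : Fin n → Ev × Ev) (henum : H.IsElimEnum enum) :
    H.VisibilityAxioms (H.vis enum) (H.sep ll enum) := by
  open TSStack.History in
  refine ⟨?_, ?_, ?_, fun x hx => exists_post hll hstruct henum hx⟩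
  · intro u₁ o₁ u₂ _ ho₁c hu₂c hu₁ _ hu₂ hvis hou huu
    obtain ⟨o₂, ho₂, hvis₂, hsep⟩ := exists_vis_sep hll hpop hstruct henum hu₂c hu₁ hu₂ hvis
      (fun h => hou (Or.inr h)) (fun h => huu (Or.inl h)) (fun h => huu (Or.inr h))
    -- The new pop lies in the closure because it is separated before `o₁`, which does.
    exact ⟨o₂, ho₁c.of_step (Or.inr hsep), ho₂, hvis₂, hsep⟩
  · intro u o₁ o₂ _ _ _ _ ho₁ ho₂ h₁ h₂
    exact hstruct.pop_id_inj _ _ ho₁ ho₂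
      ((sameId_of_vis henum h₁).symm.trans (sameId_of_vis henum h₂))
  · intro x y _ _ hxy
    exact noFuture_constraintAt hll hpop hkey hstruct henum le_rfl x y hxy
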